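/- **Setting.** Let $f:\mathbb R^n\to\mathbb R$ be twice continuously differentiable with $\lambda_1 I\preceq\nabla^2 f(x)\preceq\lambda_n I$ for all $x$, where $0<\lambda_1\le\lambda_n$; let $x^*$ be its minimizer and $f^*=f(x^*)$. Fix $c,\bar\eta,\tau\in(0,1)$, $0<\theta<c/2$, $0<t_0\le t_{\max}$ and $x_0\in\mathbb R^n$. The linesearch Newton-CG method with controllable noise starts from $(x_0,t_0)$ and performs for $k=0,1,2,\dots$ the following iteration, in which $g_k$ and $H_k$ are random estimates of $\nabla f(x_k)$ and $\nabla^2f(x_k)$. 1. Choose $\eta_k\in(0,\bar\eta)$. 2. Apply the conjugate gradient method with null initial guess to $H_ks=-g_k$ and let $s_k$ be an iterate of it with $H_ks_k=-g_k+r_k$, $\|r_k\|\le\eta_k\|g_k\|$. 3. Compute noisy values $\tilde f(x_k)$, $\tilde f(x_k+t_ks_k)$ whose errors $|f-\tilde f|$ at the two points are at most $-\theta t_ks_k^Tg_k$. 4. If $\tilde f(x_k+t_ks_k)\le\tilde f(x_k)+c\,t_ks_k^Tg_k$, set $x_{k+1}=x_k+t_ks_k$ and $t_{k+1}=\min\{t_{\max},\tau^{-1}t_k\}$;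 otherwise set $x_{k+1}=x_k$ and $t_{k+1}=\tau t_k$. Assume that $\lambda_1I\preceq H_k\preceq\lambda_nI$ for all $k$ and all realizations, and that the gradient estimates are $(1-\delta_g)$-probabilistically sufficiently accurate: for all $k\ge0$, almost surely $$P\big(\|g_k-\nabla f(x_k)\|\le t_k\eta_k\|g_k\| \;\big|\; \mathcal F_{k-1}\big)\ge 1-\delta_g ,$$ where $(\mathcal F_{k-1})_{k\ge 0}$ is a filtration such that $\mathcal F_{k-1}$ contains the history of the algorithm (gradient and Hessian estimates, forcing terms, steps, noisy function values) of the iterations $0,\dots,k-1$. Call $\kappa_1,\kappa_2,\beta>0$ *step constants* if, for all $k$ and all realizations, $$\kappa_1\|g_k\|\le\|s_k\|\le\kappa_2\|g_k\|,\qquad -g_k^Ts_k\ge\beta\|s_k\|^2,$$ and $\frac{1-\bar\eta}{\lambda_n}\le\kappa_1\le\kappa_2\le\frac1{\lambda_1}$, $\beta\ge\lambda_1$. For $0<\epsilon\le f(x_0)-f^*$ let $N_\epsilon$ be the smallest $k$ with $f(x_k)-f^*\le\epsilon$ ($\infty$ if there is none). **Theorem.** Let $0<\delta_g<\frac12$.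 Then $\kappa_1=\frac{1-\bar\eta}{\lambda_n}$, $\kappa_2=\frac1{\lambda_1}$, $\beta=\lambda_1$ are step constants. Moreover, let $\kappa_1,\kappa_2,\beta$ be any step constants, put $$\hat t=\frac{2\kappa_1\beta}{\kappa_1\lambda_n+2}(1-c-2\theta),$$ and let $0<\bar t\le\min\{\hat t,\tau t_0\}$ be such that either * $\bar t=\tau^jt_0$ and $t_0=\tau^it_{\max}$ for some integers $i,j\ge0$ (for instance $\bar t=\hat t$, if $\hat t$ itself has this form), or * $\bar t\le\tau\hat t$ (with no condition on $t_0$, $t_{\max}$ and $\tau$ besides the above). Then $M=\dfrac{2(c-2\theta)\beta\kappa_1^2\lambda_1\bar t}{(1+t_{\max})^2}$ lies in $(0,1)$ and $$\mathbb E[N_\epsilon]\le\frac{2(1-\delta_g)}{(1-2\delta_g)^2}\left[2\log_{1/(1-M)}\left(\frac{f(x_0)-f^*}{\epsilon}\right)+\log_\tau\frac{\bar t}{t_0}\right].$$ -/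

import Mathlib

open MeasureTheory ProbabilityTheory
open scoped ENNReal

namespace NewtonCG

noncomputable section

/-- The Euclidean space `ℝⁿ`. -/
abbrev E (n : ℕ) : Type := EuclideanSpace ℝ (Fin n)

/-- The matrix-vector product on `ℝⁿ`. -/
def mulVecE {n : ℕ} (A : Matrix (Fin n) (Fin n) ℝ) (v : E n) : E n :=
  WithLp.toLp 2 (A.mulVec v.ofLp)

/-- `a I ⪯ A ⪯ b I` in the Loewner order (in particular `A` is symmetric). -/
def SpectralBounds {n : ℕ} (a b : ℝ) (A : Matrix (Fin n) (Fin n) ℝ) : Prop :=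
  (A - a • (1 : Matrix (Fin n) (Fin n) ℝ)).PosSemidef ∧
    (b • (1 : Matrix (Fin n) (Fin n) ℝ) - A).PosSemidef

/-- The Hessian matrix of `f` at `x`. -/
def hessian {n : ℕ} (f : E n → ℝ) (x : E n) : Matrix (Fin n) (Fin n) ℝ :=
  Matrix.of fun i j =>
    fderiv ℝ (fderiv ℝ f) x (EuclideanSpace.single i 1) (EuclideanSpace.single j 1)

/-- `f` is twice continuously differentiable with `a I ⪯ ∇²f(x) ⪯ b I` for all `x`. -/
def SmoothStronglyConvex {n : ℕ} (a b : ℝ) (f : E n → ℝ) : Prop :=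
  ContDiff ℝ 2 f ∧ ∀ x, SpectralBounds a b (hessian f x)

/-! ### The conjugate gradient method -/

/-- The state of the conjugate gradient method: iterate, residual, search direction. -/
structure CGState (n : ℕ) where
  x : E n
  r : E n
  p : E n

/-- One iteration of the (Hestenes–Stiefel) conjugate gradient method for `A x = b`. Once the
residual vanishes the quotients below are `0 / 0 = 0` and the iterate does not change any more. -/
def cgStep {n : ℕ} (A : Matrix (Fin n) (Fin n) ℝ) (σ : CGState n) : CGState n :=
  let α : ℝ := inner ℝ σ.r σ.r / inner ℝ σ.p (mulVecE A σ.p)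
  let r' : E n := σ.r - α • mulVecE A σ.p
  { x := σ.x + α • σ.p
    r := r'
    p := r' + (inner ℝ r' r' / inner ℝ σ.r σ.r : ℝ) • σ.p }

/-- The state after `j` iterations of the conjugate gradient method for `A x = b`
with null initial guess. -/
def cgState {n : ℕ} (A : Matrix (Fin n) (Fin n) ℝ) (b : E n) : ℕ → CGState n
  | 0 => { x := 0, r := b, p := b }
  | j + 1 => cgStep A (cgState A b j)

/-- The `j`-th conjugate gradient iterate for `A x = b` with null initial guess. -/
def cgIterate {n : ℕ} (A : Matrix (Fin n) (Fin n) ℝ) (b : E n) (j : ℕ) : E n :=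
  (cgState A b j).x

/-- `s` is an inexact Newton step with forcing term `η`, that is `H s = -g + r` with
`‖r‖ ≤ η ‖g‖`, produced by the conjugate gradient method for `H s = -g` with null
initial guess. -/
def IsNewtonCGStep {n : ℕ} (H : Matrix (Fin n) (Fin n) ℝ) (g : E n) (η : ℝ) (s : E n) : Prop :=
  (∃ j : ℕ, s = cgIterate H (-g) j) ∧ ∃ r : E n, mulVecE H s = -g + r ∧ ‖r‖ ≤ η * ‖g‖

/-! ### The stochastic process generated by the algorithm -/

/-- The parameters of the algorithm. -/
structure Params where
  /-- the Armijo constant -/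
  c : ℝ
  /-- the noise control constant -/
  θ : ℝ
  /-- the upper bound for the forcing terms -/
  ηbar : ℝ
  /-- the step length update factor -/
  τ : ℝ
  /-- the maximal step length -/
  tmax : ℝ
  /-- the initial step length -/
  t0 : ℝ

/-- The admissible values of the parameters. -/
structure Params.Valid (P : Params) : Prop where
  c_pos : 0 < P.c
  c_lt_one : P.c < 1
  θ_pos : 0 < P.θ
  θ_lt : P.θ < P.c / 2
  ηbar_pos : 0 < P.ηbar
  ηbar_lt_one : P.ηbar < 1
  τ_pos : 0 < P.τ
  τ_lt_one : P.τ < 1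
  t0_pos : 0 < P.t0
  t0_le_tmax : P.t0 ≤ P.tmax

/-- The random quantities that occur in the course of the algorithm. -/
structure RandomRun (n : ℕ) (Ω : Type*) where
  /-- the iterates -/
  X : ℕ → Ω → E n
  /-- the step lengths -/
  T : ℕ → Ω → ℝ
  /-- the gradient estimators -/
  G : ℕ → Ω → E n
  /-- the Hessian estimators -/
  H : ℕ → Ω → Matrix (Fin n) (Fin n) ℝ
  /-- the forcing terms -/
  η : ℕ → Ω → ℝ
  /-- the search directions -/
  S : ℕ → Ω → E n
  /-- the noisy value of `f` at the iterate `x_k`, computed in iteration `k` -/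
  fcur : ℕ → Ω → ℝ
  /-- the noisy value of `f` at the trial point `x_k + t_k s_k`, computed in iteration `k` -/
  ftrial : ℕ → Ω → ℝ

namespace RandomRun

variable {n : ℕ} {Ω : Type*}

/-- Iteration `k` is successful: the Armijo condition holds for the noisy values. -/
def Successful (A : RandomRun n Ω) (P : Params) (k : ℕ) (ω : Ω) : Prop :=
  A.ftrial k ω ≤ A.fcur k ω + P.c * A.T k ω * inner ℝ (A.S k ω) (A.G k ω)

/-- The event that iteration `k` is true: the gradient estimate is accurate. -/
def trueEvent (A : RandomRun n Ω) (f : E n → ℝ) (k : ℕ) : Set Ω :=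
  {ω | ‖A.G k ω - gradient f (A.X k ω)‖ ≤ A.T k ω * A.η k ω * ‖A.G k ω‖}

/-- Every realization of the process is a run of the linesearch Newton-CG algorithm with
controllable noise, applied to `f` and started at `x0` with step length `t0`. -/
structure IsRun (A : RandomRun n Ω) (f : E n → ℝ) (P : Params) (x0 : E n) : Prop where
  X_zero : ∀ ω, A.X 0 ω = x0
  T_zero : ∀ ω, A.T 0 ω = P.t0
  η_mem : ∀ k ω, A.η k ω ∈ Set.Ioo 0 P.ηbar
  step : ∀ k ω, IsNewtonCGStep (A.H k ω) (A.G k ω) (A.η k ω) (A.S k ω)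
  noise_cur : ∀ k ω, |f (A.X k ω) - A.fcur k ω| ≤
    -P.θ * A.T k ω * inner ℝ (A.S k ω) (A.G k ω)
  noise_trial : ∀ k ω, |f (A.X k ω + A.T k ω • A.S k ω) - A.ftrial k ω| ≤
    -P.θ * A.T k ω * inner ℝ (A.S k ω) (A.G k ω)
  update_success : ∀ k ω, A.Successful P k ω →
    A.X (k + 1) ω = A.X k ω + A.T k ω • A.S k ω ∧
      A.T (k + 1) ω = min P.tmax (P.τ⁻¹ * A.T k ω)
  update_failure : ∀ k ω, ¬ A.Successful P k ω →
    A.X (k + 1) ω = A.X k ω ∧ A.T (k + 1) ω = P.τ * A.T k ω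

/-- `ℱ k` contains the history of the algorithm up to the beginning of iteration `k`, that is
everything that is estimated, chosen or evaluated in the iterations `0, …, k - 1`. -/
structure Adapted {mΩ : MeasurableSpace Ω} (A : RandomRun n Ω) (ℱ : Filtration ℕ mΩ) : Prop where
  G_meas : ∀ k, Measurable[ℱ (k + 1)] (A.G k)
  H_meas : ∀ k i j, Measurable[ℱ (k + 1)] fun ω => A.H k ω i j
  η_meas : ∀ k, Measurable[ℱ (k + 1)] (A.η k)
  S_meas : ∀ k, Measurable[ℱ (k + 1)] (A.S k)
  fcur_meas : ∀ k, Measurable[ℱ (k + 1)] (A.fcur k)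
  ftrial_meas : ∀ k, Measurable[ℱ (k + 1)] (A.ftrial k)

/-- The gradient estimators are `(1 - δ)`-probabilistically sufficiently accurate: the conditional
probability, given the history, that iteration `k` is true is at least `1 - δ`. -/
def GradientAccurate {mΩ : MeasurableSpace Ω} (A : RandomRun n Ω) (μ : Measure Ω)
    (ℱ : Filtration ℕ mΩ) (f : E n → ℝ) (δ : ℝ) : Prop :=
  ∀ k, ∀ᵐ ω ∂μ, 1 - δ ≤ (μ⟦A.trueEvent f k | ℱ k⟧) ω

/-- `N_ε`: the first `k` with `f(x_k) - f* ≤ ε` (`⊤` if there is none). -/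
def hittingTime (A : RandomRun n Ω) (f : E n → ℝ) (fstar ε : ℝ) (ω : Ω) : ℕ∞ :=
  ⨅ (k : ℕ) (_ : f (A.X k ω) - fstar ≤ ε), (k : ℕ∞)

/-- `κ₁, κ₂, β` are constants for the Newton-CG steps of the process:
`κ₁ ‖g_k‖ ≤ ‖s_k‖ ≤ κ₂ ‖g_k‖` and `-g_kᵀ s_k ≥ β ‖s_k‖²` in all iterations of all realizations,
with `(1 - ηbar) / lamn ≤ κ₁ ≤ κ₂ ≤ 1 / lam1` and `β ≥ lam1`. -/
structure StepConstants (A : RandomRun n Ω) (P : Params) (lam1 lamn κ₁ κ₂ β : ℝ) : Prop where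
  κ₁_pos : 0 < κ₁
  κ₂_pos : 0 < κ₂
  β_pos : 0 < β
  lower : ∀ k ω, κ₁ * ‖A.G k ω‖ ≤ ‖A.S k ω‖
  upper : ∀ k ω, ‖A.S k ω‖ ≤ κ₂ * ‖A.G k ω‖
  descent : ∀ k ω, β * ‖A.S k ω‖ ^ 2 ≤ -inner ℝ (A.G k ω) (A.S k ω)
  le_κ₁ : (1 - P.ηbar) / lamn ≤ κ₁
  κ₁_le_κ₂ : κ₁ ≤ κ₂
  κ₂_le : κ₂ ≤ 1 / lam1
  le_β : lam1 ≤ β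

end RandomRun

/-- The threshold `2 κ₁ β (1 - c - 2θ) / (κ₁ lamn + 2)` for the step length. -/
def Params.threshold (P : Params) (lamn κ₁ β : ℝ) : ℝ :=
  2 * κ₁ * β / (κ₁ * lamn + 2) * (1 - P.c - 2 * P.θ)

/-- `M = 2 (c - 2θ) β κ₁² lam1 t / (1 + tmax)²`. -/
def Params.M (P : Params) (lam1 κ₁ β t : ℝ) : ℝ :=
  2 * (P.c - 2 * P.θ) * β * κ₁ ^ 2 * lam1 * t / (1 + P.tmax) ^ 2

end

end NewtonCG

/-!
Every conjugate gradient iterate is orthogonal to its residual, hence `-gᵀs = sᵀHs` for a Newton-CG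
step `s`, and the spectral bounds on `H` give the step constants.

Call an iteration true if its gradient estimate is accurate. The reductions by `τ` that separate the
step length from `t̄`, rounded down, form an integer-valued process `ℓ` that changes by at most one
in each iteration. In a true iteration with `t_k ≤ t̂` the Armijo condition holds in spite of the
noise, so in a true iteration `|ℓ|` drops by one, unless the iteration is successful with
`t_k ≥ t̄`; but then the Polyak–Łojasiewicz inequality makes the optimality gap contract by the
factor `1 - M`. With `|ℓ|` as a potential, the number of iterations before the gap falls below `ε`
is at most `ℓ_0` plus twice the number of contractions plus twice the number of false iterations.
False iterations have conditional probability at most `δ`, so that in expectation their number up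
to `N_ε` is at most `δ 𝔼[N_ε]`, and solving for `𝔼[N_ε]` gives the bound.
-/

namespace NewtonCG

/-! ### Orthogonality in the conjugate gradient method -/

section ConjugateGradient

open scoped InnerProductSpace

variable {F : Type*} [NormedAddCommGroup F] [InnerProductSpace ℝ F] {T : F →ₗ[ℝ] F}

/-- `x`, `r` and `p` are the iterates, residuals and search directions of the conjugate gradient
method for `T x = b` with null initial guess, with the convention `0 / 0 = 0` in the quotients. -/
structure IsConjugateGradient (T : F →ₗ[ℝ] F) (b : F) (x r p : ℕ → F) : Prop where
  x_zero : x 0 = 0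
  r_zero : r 0 = b
  p_zero : p 0 = b
  x_succ : ∀ j, x (j + 1) = x j + (⟪r j, r j⟫_ℝ / ⟪p j, T (p j)⟫_ℝ) • p j
  r_succ : ∀ j, r (j + 1) = r j - (⟪r j, r j⟫_ℝ / ⟪p j, T (p j)⟫_ℝ) • T (p j)
  p_succ : ∀ j, p (j + 1) = r (j + 1) + (⟪r (j + 1), r (j + 1)⟫_ℝ / ⟪r j, r j⟫_ℝ) • p j

namespace IsConjugateGradient

variable {b : F} {x r p : ℕ → F}

lemma r_eq (h : IsConjugateGradient T b x r p) (j : ℕ) : r j = b - T (x j) := by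
  induction j with
  | zero => rw [h.r_zero, h.x_zero, map_zero, sub_zero]
  | succ j ih => rw [h.r_succ, h.x_succ, map_add, map_smul, ih]; abel

lemma p_eq_zero (h : IsConjugateGradient T b x r p) {j : ℕ} (hr : r j = 0) : p j = 0 := by
  cases j with
  | zero => rw [h.p_zero, ← h.r_zero, hr]
  | succ j => rw [h.p_succ, hr]; simp

lemma stepsize_mul_of_inner_eq (hT : ∀ v ≠ 0, ⟪v, T v⟫_ℝ ≠ 0) {j : ℕ}
    (hpr : ⟪p j, r j⟫_ℝ = ⟪r j, r j⟫_ℝ) :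
    ⟪r j, r j⟫_ℝ / ⟪p j, T (p j)⟫_ℝ * ⟪p j, T (p j)⟫_ℝ = ⟪r j, r j⟫_ℝ := by
  by_cases hp : p j = 0
  · rw [← hpr, hp]; simp
  · exact div_mul_cancel₀ _ (hT _ hp)

lemma inner_p_r (h : IsConjugateGradient T b x r p) (hT : ∀ v ≠ 0, ⟪v, T v⟫_ℝ ≠ 0) (j : ℕ) :
    ⟪p j, r j⟫_ℝ = ⟪r j, r j⟫_ℝ := by
  induction j with
  | zero => rw [h.p_zero, h.r_zero]
  | succ j ih =>
    have horth : ⟪p j, r (j + 1)⟫_ℝ = 0 := by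
      rw [h.r_succ, inner_sub_right, real_inner_smul_right, stepsize_mul_of_inner_eq hT ih, ih,
        sub_self]
    rw [h.p_succ, inner_add_left, real_inner_smul_left, horth, mul_zero, add_zero]

lemma stepsize_mul (h : IsConjugateGradient T b x r p) (hT : ∀ v ≠ 0, ⟪v, T v⟫_ℝ ≠ 0) (j : ℕ) :
    ⟪r j, r j⟫_ℝ / ⟪p j, T (p j)⟫_ℝ * ⟪p j, T (p j)⟫_ℝ = ⟪r j, r j⟫_ℝ :=
  stepsize_mul_of_inner_eq hT (h.inner_p_r hT j)

lemma inner_p_r_succ (h : IsConjugateGradient T b x r p) (hT : ∀ v ≠ 0, ⟪v, T v⟫_ℝ ≠ 0) (j : ℕ) :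
    ⟪p j, r (j + 1)⟫_ℝ = 0 := by
  rw [h.r_succ, inner_sub_right, real_inner_smul_right, h.stepsize_mul hT, h.inner_p_r hT, sub_self]

lemma inner_r_apply_p (h : IsConjugateGradient T b x r p) {j : ℕ}
    (hconj : ∀ i < j, ⟪p i, T (p j)⟫_ℝ = 0) {i : ℕ} (hi : i ≤ j) :
    ⟪r i, T (p j)⟫_ℝ = ⟪p i, T (p j)⟫_ℝ := by
  cases i with
  | zero => rw [h.r_zero, h.p_zero]
  | succ i => rw [h.p_succ, inner_add_left, real_inner_smul_left, hconj i hi, mul_zero, add_zero]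

lemma inner_r_r_succ (h : IsConjugateGradient T b x r p) (hT : ∀ v ≠ 0, ⟪v, T v⟫_ℝ ≠ 0) {j : ℕ}
    (horth : ∀ i < j, ⟪r i, r j⟫_ℝ = 0) (hconj : ∀ i < j, ⟪p i, T (p j)⟫_ℝ = 0) {i : ℕ}
    (hi : i ≤ j) : ⟪r i, r (j + 1)⟫_ℝ = 0 := by
  rw [h.r_succ, inner_sub_right, real_inner_smul_right, h.inner_r_apply_p hconj hi]
  rcases hi.lt_or_eq with hlt | rfl
  · rw [horth i hlt, hconj i hlt, mul_zero, sub_zero]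
  · rw [h.stepsize_mul hT, sub_self]

lemma inner_p_apply_p_succ (h : IsConjugateGradient T b x r p) (hsymm : T.IsSymmetric)
    (hT : ∀ v ≠ 0, ⟪v, T v⟫_ℝ ≠ 0) {j : ℕ} (horth : ∀ i ≤ j, ⟪r i, r (j + 1)⟫_ℝ = 0)
    (hconj : ∀ i < j, ⟪p i, T (p j)⟫_ℝ = 0) {i : ℕ} (hi : i ≤ j) :
    ⟪p i, T (p (j + 1))⟫_ℝ = 0 := by
  by_cases hp : p i = 0
  · rw [hp, inner_zero_left]
  have hri : ⟪r i, r i⟫_ℝ ≠ 0 := fun h0 => hp (h.p_eq_zero (inner_self_eq_zero.1 h0))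
  have hstep : ⟪r i, r i⟫_ℝ / ⟪p i, T (p i)⟫_ℝ ≠ 0 := div_ne_zero hri (hT _ hp)
  have hTp : ⟪r i, r i⟫_ℝ / ⟪p i, T (p i)⟫_ℝ * ⟪T (p i), r (j + 1)⟫_ℝ =
      -⟪r (i + 1), r (j + 1)⟫_ℝ := by
    rw [h.r_succ i, inner_sub_left, real_inner_smul_left, horth i hi, zero_sub, neg_neg]
  refine (mul_eq_zero.1 ?_).resolve_left hstep
  rw [← hsymm (p i) (p (j + 1)), h.p_succ j, inner_add_right, real_inner_smul_right, mul_add, hTp,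
    hsymm (p i) (p j)]
  rcases hi.lt_or_eq with hlt | rfl
  · rw [horth (i + 1) hlt, hconj i hlt]
    simp
  · rw [mul_left_comm, h.stepsize_mul hT, div_mul_cancel₀ _ hri, neg_add_cancel]

lemma orthogonal_and_conjugate (h : IsConjugateGradient T b x r p) (hsymm : T.IsSymmetric)
    (hT : ∀ v ≠ 0, ⟪v, T v⟫_ℝ ≠ 0) (j : ℕ) :
    (∀ i < j, ⟪r i, r j⟫_ℝ = 0) ∧ ∀ i < j, ⟪p i, T (p j)⟫_ℝ = 0 := by
  induction j with
  | zero => exact ⟨fun i hi => absurd hi i.not_lt_zero, fun i hi => absurd hi i.not_lt_zero⟩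
  | succ j ih =>
    have horth : ∀ i ≤ j, ⟪r i, r (j + 1)⟫_ℝ = 0 := fun i => h.inner_r_r_succ hT ih.1 ih.2
    exact ⟨fun i hi => horth i (Nat.le_of_lt_succ hi),
      fun i hi => h.inner_p_apply_p_succ hsymm hT horth ih.2 (Nat.le_of_lt_succ hi)⟩

lemma inner_x_apply_p (h : IsConjugateGradient T b x r p) (hsymm : T.IsSymmetric)
    (hT : ∀ v ≠ 0, ⟪v, T v⟫_ℝ ≠ 0) {j m : ℕ} (hjm : j ≤ m) : ⟪x j, T (p m)⟫_ℝ = 0 := by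
  induction j with
  | zero => rw [h.x_zero, inner_zero_left]
  | succ j ih =>
    rw [h.x_succ, inner_add_left, real_inner_smul_left, ih (Nat.le_of_succ_le hjm),
      (h.orthogonal_and_conjugate hsymm hT m).2 j hjm, mul_zero, add_zero]

lemma inner_x_r (h : IsConjugateGradient T b x r p) (hsymm : T.IsSymmetric)
    (hT : ∀ v ≠ 0, ⟪v, T v⟫_ℝ ≠ 0) (j : ℕ) : ⟪x j, r j⟫_ℝ = 0 := by
  induction j with
  | zero => rw [h.x_zero, inner_zero_left]
  | succ j ih =>
    rw [h.x_succ, inner_add_left, real_inner_smul_left, h.inner_p_r_succ hT, h.r_succ,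
      inner_sub_right, real_inner_smul_right, ih, h.inner_x_apply_p hsymm hT le_rfl]
    simp

lemma inner_x_apply_x (h : IsConjugateGradient T b x r p) (hsymm : T.IsSymmetric)
    (hT : ∀ v ≠ 0, ⟪v, T v⟫_ℝ ≠ 0) (j : ℕ) : ⟪x j, T (x j)⟫_ℝ = ⟪x j, b⟫_ℝ := by
  have horth := h.inner_x_r hsymm hT j
  rw [h.r_eq, inner_sub_right] at horth
  exact (sub_eq_zero.1 horth).symm

end IsConjugateGradient

lemma isConjugateGradient_cgState {n : ℕ} (A : Matrix (Fin n) (Fin n) ℝ) (b : E n) :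
    IsConjugateGradient (Matrix.toEuclideanLin A) b (cgIterate A b) (fun j => (cgState A b j).r)
      (fun j => (cgState A b j).p) where
  x_zero := rfl
  r_zero := rfl
  p_zero := rfl
  x_succ _ := rfl
  r_succ _ := rfl
  p_succ _ := rfl

end ConjugateGradient

/-! ### Newton-CG steps -/

section Step

lemma norm_apply_le_of_isPositive {F : Type*} [NormedAddCommGroup F] [InnerProductSpace ℝ F]
    {T : F →ₗ[ℝ] F} (hT : T.IsPositive) {b : ℝ} (hb : 0 < b)
    (hTb : ∀ x, inner ℝ x (T x) ≤ b * ‖x‖ ^ 2) (x : F) : ‖T x‖ ≤ b * ‖x‖ := by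
  have hexpand : inner ℝ (b • x - T x) (T (b • x - T x)) =
      b ^ 2 * inner ℝ x (T x) - 2 * b * ‖T x‖ ^ 2 + inner ℝ (T x) (T (T x)) := by
    simp only [map_sub, map_smul, inner_sub_left, inner_sub_right, real_inner_smul_left,
      real_inner_smul_right, ← hT.isSymmetric x, real_inner_self_eq_norm_sq]
    ring
  have hnonneg : 0 ≤ inner ℝ (b • x - T x) (T (b • x - T x)) := hT.inner_nonneg_right _
  have hsq : b * ‖T x‖ ^ 2 ≤ b * (b * ‖x‖) ^ 2 := by
    linarith [mul_le_mul_of_nonneg_left (hTb x) (sq_nonneg b), hTb (T x)]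
  exact le_of_sq_le_sq (le_of_mul_le_mul_left hsq hb) (by positivity)

variable {n : ℕ} {H : Matrix (Fin n) (Fin n) ℝ} {g s : E n} {η a b : ℝ}

lemma toEuclideanLin_eq_mulVecE (v : E n) : Matrix.toEuclideanLin H v = mulVecE H v := rfl

lemma SpectralBounds.le_inner (hH : SpectralBounds a b H) (v : E n) :
    a * ‖v‖ ^ 2 ≤ inner ℝ v (mulVecE H v) := by
  have h := (Matrix.isPositive_toEuclideanLin_iff.2 hH.1).inner_nonneg_right v
  simpa [toEuclideanLin_eq_mulVecE, inner_sub_right, real_inner_smul_right] using h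

lemma SpectralBounds.inner_le (hH : SpectralBounds a b H) (v : E n) :
    inner ℝ v (mulVecE H v) ≤ b * ‖v‖ ^ 2 := by
  have h := (Matrix.isPositive_toEuclideanLin_iff.2 hH.2).inner_nonneg_right v
  simpa [toEuclideanLin_eq_mulVecE, inner_sub_right, real_inner_smul_right] using h

lemma SpectralBounds.isPositive (hH : SpectralBounds a b H) (ha : 0 ≤ a) :
    (Matrix.toEuclideanLin H).IsPositive := by
  have h := hH.1.add (Matrix.PosSemidef.one.smul ha)
  rw [sub_add_cancel] at h
  exact Matrix.isPositive_toEuclideanLin_iff.2 h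

lemma SpectralBounds.inner_ne_zero (hH : SpectralBounds a b H) (ha : 0 < a) {v : E n}
    (hv : v ≠ 0) : inner ℝ v (mulVecE H v) ≠ 0 :=
  ((mul_pos ha (pow_pos (norm_pos_iff.2 hv) 2)).trans_le (hH.le_inner v)).ne'

lemma IsNewtonCGStep.neg_inner_eq (hs : IsNewtonCGStep H g η s) (hH : SpectralBounds a b H)
    (ha : 0 < a) : -inner ℝ g s = inner ℝ s (mulVecE H s) := by
  obtain ⟨⟨j, rfl⟩, -⟩ := hs
  have h := (isConjugateGradient_cgState H (-g)).inner_x_apply_x (hH.isPositive ha.le).isSymmetric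
    (fun _ => hH.inner_ne_zero ha) j
  rw [real_inner_comm, ← inner_neg_right]
  exact h.symm

lemma IsNewtonCGStep.descent (hs : IsNewtonCGStep H g η s) (hH : SpectralBounds a b H)
    (ha : 0 < a) : a * ‖s‖ ^ 2 ≤ -inner ℝ g s :=
  (hH.le_inner s).trans (hs.neg_inner_eq hH ha).ge

lemma mul_norm_le_of_descent {F : Type*} [NormedAddCommGroup F] [InnerProductSpace ℝ F]
    {β : ℝ} {g s : F} (h : β * ‖s‖ ^ 2 ≤ -inner ℝ g s) : β * ‖s‖ ≤ ‖g‖ := by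
  rcases (norm_nonneg s).eq_or_lt with hs | hs
  · rw [← hs, mul_zero]
    exact norm_nonneg g
  · have hcs : -inner ℝ g s ≤ ‖g‖ * ‖s‖ := neg_le.1 (neg_le_of_abs_le (abs_real_inner_le_norm g s))
    exact le_of_mul_le_mul_right (by linarith) hs

lemma IsNewtonCGStep.norm_le (hs : IsNewtonCGStep H g η s) (hH : SpectralBounds a b H)
    (ha : 0 < a) : ‖s‖ ≤ 1 / a * ‖g‖ := by
  rw [one_div_mul_eq_div, le_div_iff₀' ha]
  exact mul_norm_le_of_descent (hs.descent hH ha)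

lemma IsNewtonCGStep.le_norm (hs : IsNewtonCGStep H g η s) (hH : SpectralBounds a b H)
    (ha : 0 ≤ a) (hb : 0 < b) : (1 - η) / b * ‖g‖ ≤ ‖s‖ := by
  obtain ⟨-, r, hr, hrg⟩ := hs
  have hHs : ‖mulVecE H s‖ ≤ b * ‖s‖ :=
    norm_apply_le_of_isPositive (hH.isPositive ha) hb hH.inner_le s
  have hg : ‖g‖ ≤ ‖r‖ + ‖mulVecE H s‖ := by
    have h := norm_sub_le r (mulVecE H s)
    rwa [hr, sub_add_cancel_right, neg_neg, ← hr] at h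
  rw [div_mul_eq_mul_div, div_le_iff₀' hb]
  linarith

end Step

lemma RandomRun.IsRun.stepConstants {n : ℕ} {Ω : Type*} {f : E n → ℝ} {x0 : E n}
    {lam1 lamn : ℝ} {P : Params} {A : RandomRun n Ω} (hrun : A.IsRun f P x0) (hP : P.Valid)
    (hlam1 : 0 < lam1) (hlamn : lam1 ≤ lamn)
    (hH : ∀ k ω, SpectralBounds lam1 lamn (A.H k ω)) :
    A.StepConstants P lam1 lamn ((1 - P.ηbar) / lamn) (1 / lam1) lam1 where
  κ₁_pos := div_pos (sub_pos.2 hP.ηbar_lt_one) (hlam1.trans_le hlamn)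
  κ₂_pos := one_div_pos.2 hlam1
  β_pos := hlam1
  lower k ω := by
    have hpos : 0 < lamn := hlam1.trans_le hlamn
    have hη : 1 - P.ηbar ≤ 1 - A.η k ω := sub_le_sub_left (hrun.η_mem k ω).2.le 1
    exact le_trans (by gcongr) ((hrun.step k ω).le_norm (hH k ω) hlam1.le hpos)
  upper k ω := (hrun.step k ω).norm_le (hH k ω) hlam1
  descent k ω := (hrun.step k ω).descent (hH k ω) hlam1
  le_κ₁ := le_rfl
  κ₁_le_κ₂ := div_le_div₀ zero_le_one (sub_le_self 1 hP.ηbar_pos.le) hlam1 hlamn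
  κ₂_le := le_rfl
  le_β := le_rfl

/-! ### Quadratic bounds -/

section Quadratic

lemma le_add_mul_of_deriv_le {φ φ' : ℝ → ℝ} {b : ℝ} (hφ : ∀ t, HasDerivAt φ (φ' t) t)
    (hb : ∀ t, φ' t ≤ b) {t : ℝ} (ht : 0 ≤ t) : φ t ≤ φ 0 + b * t := by
  have hB (t : ℝ) : HasDerivAt (fun t => φ 0 + b * t) b t := by
    simpa using ((hasDerivAt_id' t).const_mul b).const_add (φ 0)
  exact image_le_of_deriv_right_le_deriv_boundary
    (HasDerivAt.continuousOn fun t _ => hφ t) (fun t _ => (hφ t).hasDerivWithinAt) (by simp)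
    (HasDerivAt.continuousOn fun t _ => hB t) (fun t _ => (hB t).hasDerivWithinAt)
    (fun t _ => hb t) (Set.right_mem_Icc.2 ht)

lemma apply_one_le_of_deriv_deriv_le {φ φ' φ'' : ℝ → ℝ} {b : ℝ}
    (hφ : ∀ t, HasDerivAt φ (φ' t) t) (hφ' : ∀ t, HasDerivAt φ' (φ'' t) t)
    (hb : ∀ t, φ'' t ≤ b) : φ 1 ≤ φ 0 + φ' 0 + b / 2 := by
  have hB (t : ℝ) : HasDerivAt (fun t => φ 0 + φ' 0 * t + b / 2 * t ^ 2) (φ' 0 + b * t) t := by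
    refine ((((hasDerivAt_id' t).const_mul (φ' 0)).const_add (φ 0)).fun_add
      ((hasDerivAt_pow 2 t).const_mul (b / 2))).congr_deriv ?_
    push_cast
    ring
  have h := image_le_of_deriv_right_le_deriv_boundary (a := 0) (b := 1)
    (HasDerivAt.continuousOn fun t _ => hφ t) (fun t _ => (hφ t).hasDerivWithinAt)
    (by simp) (HasDerivAt.continuousOn fun t _ => hB t) (fun t _ => (hB t).hasDerivWithinAt)
    (fun t ht => le_add_mul_of_deriv_le hφ' hb ht.1)
  simpa using h (Set.right_mem_Icc.2 zero_le_one)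

lemma le_add_fderiv_add_of_fderiv_fderiv_le {F : Type*} [NormedAddCommGroup F] [NormedSpace ℝ F]
    {f : F → ℝ} (hf : ContDiff ℝ 2 f) {x d : F} {b : ℝ}
    (hb : ∀ y, fderiv ℝ (fderiv ℝ f) y d d ≤ b) : f (x + d) ≤ f x + fderiv ℝ f x d + b / 2 := by
  have hline (t : ℝ) : HasDerivAt (fun t : ℝ => x + t • d) d t := by
    simpa using ((hasDerivAt_id t).smul_const d).const_add x
  have hf' : Differentiable ℝ (fderiv ℝ f) :=
    (hf.fderiv_right (m := 1) (by norm_num)).differentiable one_ne_zero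
  have h := apply_one_le_of_deriv_deriv_le
    (fun t => ((hf.differentiable two_ne_zero) (x + t • d)).hasFDerivAt.comp_hasDerivAt t (hline t))
    (fun t => (ContinuousLinearMap.apply ℝ ℝ d).hasFDerivAt.comp_hasDerivAt t
      ((hf' (x + t • d)).hasFDerivAt.comp_hasDerivAt t (hline t)))
    (fun t => hb (x + t • d))
  simpa using h

variable {n : ℕ} {f : E n → ℝ} {a b : ℝ}

lemma fderiv_fderiv_eq_inner_hessian (x d : E n) :
    fderiv ℝ (fderiv ℝ f) x d d = inner ℝ d (mulVecE (hessian f x) d) := by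
  have hd : d = ∑ i, d i • (EuclideanSpace.single i 1 : E n) := by
    simpa using ((EuclideanSpace.basisFun (Fin n) ℝ).sum_repr d).symm
  conv_lhs => rw [hd]
  simp only [map_sum, map_smul, FunLike.coe_sum, Finset.sum_apply, FunLike.coe_smul, Pi.smul_apply,
    smul_eq_mul, PiLp.inner_apply, mulVecE, Matrix.mulVec, dotProduct, hessian, Matrix.of_apply,
    RCLike.inner_apply, conj_trivial, Finset.mul_sum, Finset.sum_mul]
  rw [Finset.sum_comm]
  exact Finset.sum_congr rfl fun i _ => Finset.sum_congr rfl fun j _ => by ring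

lemma SmoothStronglyConvex.le_quadratic (hf : SmoothStronglyConvex a b f) (x d : E n) :
    f (x + d) ≤ f x + inner ℝ (gradient f x) d + b / 2 * ‖d‖ ^ 2 := by
  rw [inner_gradient_left, div_mul_eq_mul_div]
  exact le_add_fderiv_add_of_fderiv_fderiv_le hf.1 fun y =>
    (fderiv_fderiv_eq_inner_hessian y d).trans_le ((hf.2 y).inner_le d)

lemma SmoothStronglyConvex.quadratic_le (hf : SmoothStronglyConvex a b f) (x d : E n) :
    f x + inner ℝ (gradient f x) d + a / 2 * ‖d‖ ^ 2 ≤ f (x + d) := by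
  have hneg (y : E n) : fderiv ℝ (fderiv ℝ (-f)) y d d ≤ -(a * ‖d‖ ^ 2) := by
    rw [show fderiv ℝ (-f) = -fderiv ℝ f from funext fun _ => fderiv_neg, fderiv_neg]
    exact neg_le_neg (((hf.2 y).le_inner d).trans_eq (fderiv_fderiv_eq_inner_hessian y d).symm)
  have h := le_add_fderiv_add_of_fderiv_fderiv_le (f := -f) hf.1.neg hneg (x := x)
  simp only [fderiv_neg, Pi.neg_apply, FunLike.coe_neg] at h
  rw [inner_gradient_left]
  linarith

lemma SmoothStronglyConvex.polyak_lojasiewicz (hf : SmoothStronglyConvex a b f) (ha : 0 < a)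
    (x y : E n) : 2 * a * (f x - f y) ≤ ‖gradient f x‖ ^ 2 := by
  have hquad := hf.quadratic_le x (y - x)
  rw [add_sub_cancel] at hquad
  have hcs := neg_le_of_abs_le (abs_real_inner_le_norm (gradient f x) (y - x))
  nlinarith [sq_nonneg (‖gradient f x‖ - a * ‖y - x‖)]

lemma SmoothStronglyConvex.continuous_gradient (hf : SmoothStronglyConvex a b f) :
    Continuous (gradient f) :=
  (InnerProductSpace.toDual ℝ (E n)).symm.continuous.comp (hf.1.continuous_fderiv two_ne_zero)

end Quadratic

/-! ### Decrease of the objective along a run -/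

namespace Params

variable {P : Params}

lemma Valid.tmax_pos (hP : P.Valid) : 0 < P.tmax := hP.t0_pos.trans_le hP.t0_le_tmax

lemma Valid.one_lt_inv_τ (hP : P.Valid) : 1 < P.τ⁻¹ := one_lt_inv_iff₀.2 ⟨hP.τ_pos, hP.τ_lt_one⟩

lemma Valid.c_sub_pos (hP : P.Valid) : 0 < P.c - 2 * P.θ := by linarith [hP.θ_lt]

lemma mul_le_of_le_threshold {lamn κ₁ β t : ℝ} (hlamn : 0 ≤ lamn) (hκ₁ : 0 < κ₁)
    (ht : t ≤ P.threshold lamn κ₁ β) :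
    t * (1 / κ₁ + lamn / 2) ≤ β * (1 - P.c - 2 * P.θ) := by
  have hsum : 1 / κ₁ + lamn / 2 = (κ₁ * lamn + 2) / (2 * κ₁) := by field_simp; ring
  rw [threshold, div_mul_eq_mul_div, le_div_iff₀ (by positivity)] at ht
  rw [hsum, ← mul_div_assoc, div_le_iff₀ (by positivity)]
  linarith

end Params

lemma inner_le_of_norm_sub_le {F : Type*} [NormedAddCommGroup F] [InnerProductSpace ℝ F]
    {g u s : F} {t κ : ℝ} (ht : 0 ≤ t) (hκ : 0 < κ) (hs : κ * ‖g‖ ≤ ‖s‖)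
    (hu : ‖g - u‖ ≤ t * ‖g‖) : inner ℝ u s ≤ inner ℝ g s + t * ‖s‖ ^ 2 / κ := by
  have hcs : inner ℝ g s - inner ℝ u s ≥ -(‖g - u‖ * ‖s‖) := by
    rw [← inner_sub_left]
    exact neg_le_of_abs_le (abs_real_inner_le_norm (g - u) s)
  have hnorm : ‖g - u‖ * ‖s‖ ≤ t * ‖s‖ ^ 2 / κ := by
    rw [le_div_iff₀ hκ]
    calc ‖g - u‖ * ‖s‖ * κ ≤ t * ‖g‖ * ‖s‖ * κ := by gcongr
      _ = t * ‖s‖ * (κ * ‖g‖) := by ring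
      _ ≤ t * ‖s‖ * ‖s‖ := by gcongr
      _ = t * ‖s‖ ^ 2 := by ring
  linarith

namespace RandomRun

variable {n : ℕ} {Ω : Type*} {f : E n → ℝ} {x0 : E n} {P : Params} {A : RandomRun n Ω}
  {lam1 lamn κ₁ κ₂ β tbar : ℝ} {k : ℕ} {ω : Ω}

lemma IsRun.T_pos (hrun : A.IsRun f P x0) (hP : P.Valid) (k : ℕ) (ω : Ω) : 0 < A.T k ω := by
  induction k with
  | zero => rw [hrun.T_zero]; exact hP.t0_pos
  | succ k ih =>
    by_cases hs : A.Successful P k ω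
    · rw [(hrun.update_success k ω hs).2]
      exact lt_min hP.tmax_pos (mul_pos (inv_pos.2 hP.τ_pos) ih)
    · rw [(hrun.update_failure k ω hs).2]
      exact mul_pos hP.τ_pos ih

lemma IsRun.T_le_tmax (hrun : A.IsRun f P x0) (hP : P.Valid) (k : ℕ) (ω : Ω) :
    A.T k ω ≤ P.tmax := by
  induction k with
  | zero => rw [hrun.T_zero]; exact hP.t0_le_tmax
  | succ k ih =>
    by_cases hs : A.Successful P k ω
    · rw [(hrun.update_success k ω hs).2]
      exact min_le_left _ _
    · rw [(hrun.update_failure k ω hs).2]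
      exact (mul_le_of_le_one_left (hrun.T_pos hP k ω).le hP.τ_lt_one.le).trans ih

lemma IsRun.norm_sub_gradient_le (hrun : A.IsRun f P x0) (hP : P.Valid)
    (htrue : ω ∈ A.trueEvent f k) :
    ‖A.G k ω - gradient f (A.X k ω)‖ ≤ A.T k ω * ‖A.G k ω‖ := by
  refine le_trans htrue (mul_le_mul_of_nonneg_right ?_ (norm_nonneg _))
  exact mul_le_of_le_one_right (hrun.T_pos hP k ω).le
    ((hrun.η_mem k ω).2.le.trans hP.ηbar_lt_one.le)

lemma IsRun.norm_gradient_le (hrun : A.IsRun f P x0) (hP : P.Valid)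
    (htrue : ω ∈ A.trueEvent f k) :
    ‖gradient f (A.X k ω)‖ ≤ (1 + P.tmax) * ‖A.G k ω‖ :=
  calc ‖gradient f (A.X k ω)‖
      ≤ ‖A.G k ω‖ + ‖A.G k ω - gradient f (A.X k ω)‖ := by
        rw [norm_sub_rev]
        exact norm_le_norm_add_norm_sub' _ _
    _ ≤ ‖A.G k ω‖ + P.tmax * ‖A.G k ω‖ := by
        gcongr
        exact (hrun.norm_sub_gradient_le hP htrue).trans (by gcongr; exact hrun.T_le_tmax hP k ω)
    _ = (1 + P.tmax) * ‖A.G k ω‖ := by ring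

lemma IsRun.trial_le (hrun : A.IsRun f P x0) (hP : P.Valid)
    (hf : SmoothStronglyConvex lam1 lamn f) (hlamn : 0 ≤ lamn)
    (hc : A.StepConstants P lam1 lamn κ₁ κ₂ β) (htrue : ω ∈ A.trueEvent f k)
    (hT : A.T k ω ≤ P.threshold lamn κ₁ β) :
    f (A.X k ω + A.T k ω • A.S k ω) ≤
      f (A.X k ω) + (P.c + 2 * P.θ) * A.T k ω * inner ℝ (A.G k ω) (A.S k ω) := by
  have hTpos : 0 < A.T k ω := hrun.T_pos hP k ω
  have hκ₁ := hc.κ₁_pos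
  have hquad := hf.le_quadratic (A.X k ω) (A.T k ω • A.S k ω)
  rw [real_inner_smul_right, norm_smul, Real.norm_of_nonneg hTpos.le, mul_pow] at hquad
  have hinner := inner_le_of_norm_sub_le hTpos.le hκ₁ (hc.lower k ω)
    (hrun.norm_sub_gradient_le hP htrue)
  have hsmall := Params.mul_le_of_le_threshold hlamn hκ₁ hT
  have hfac : 0 ≤ 1 - P.c - 2 * P.θ :=
    nonneg_of_mul_nonneg_right (le_trans (by positivity) hsmall) hc.β_pos
  have hdesc : A.T k ω * (1 / κ₁ + lamn / 2) * ‖A.S k ω‖ ^ 2 ≤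
      (1 - P.c - 2 * P.θ) * -inner ℝ (A.G k ω) (A.S k ω) :=
    calc A.T k ω * (1 / κ₁ + lamn / 2) * ‖A.S k ω‖ ^ 2
        ≤ β * (1 - P.c - 2 * P.θ) * ‖A.S k ω‖ ^ 2 := by gcongr
      _ = (1 - P.c - 2 * P.θ) * (β * ‖A.S k ω‖ ^ 2) := by ring
      _ ≤ _ := mul_le_mul_of_nonneg_left (hc.descent k ω) hfac
  linear_combination hquad + A.T k ω * hinner + A.T k ω * hdesc

lemma IsRun.successful_of_le_threshold (hrun : A.IsRun f P x0) (hP : P.Valid)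
    (hf : SmoothStronglyConvex lam1 lamn f) (hlamn : 0 ≤ lamn)
    (hc : A.StepConstants P lam1 lamn κ₁ κ₂ β) (htrue : ω ∈ A.trueEvent f k)
    (hT : A.T k ω ≤ P.threshold lamn κ₁ β) : A.Successful P k ω := by
  have hcur := hrun.noise_cur k ω
  have htrial := hrun.noise_trial k ω
  have hle := hrun.trial_le hP hf hlamn hc htrue hT
  rw [real_inner_comm] at hle
  unfold Successful
  linarith [le_of_abs_le hcur, neg_le_of_abs_le htrial]

lemma IsRun.decrease (hrun : A.IsRun f P x0) (hs : A.Successful P k ω) :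
    f (A.X (k + 1) ω) ≤ f (A.X k ω) -
      (P.c - 2 * P.θ) * A.T k ω * -inner ℝ (A.G k ω) (A.S k ω) := by
  have hcur := hrun.noise_cur k ω
  have htrial := hrun.noise_trial k ω
  unfold Successful at hs
  rw [(hrun.update_success k ω hs).1, real_inner_comm]
  linarith [neg_le_of_abs_le hcur, le_of_abs_le htrial]

lemma IsRun.f_succ_le (hrun : A.IsRun f P x0) (hP : P.Valid)
    (hc : A.StepConstants P lam1 lamn κ₁ κ₂ β) (k : ℕ) (ω : Ω) :
    f (A.X (k + 1) ω) ≤ f (A.X k ω) := by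
  by_cases hs : A.Successful P k ω
  · have hdescent : 0 ≤ -inner ℝ (A.G k ω) (A.S k ω) :=
      (mul_nonneg hc.β_pos.le (sq_nonneg _)).trans (hc.descent k ω)
    exact (hrun.decrease hs).trans (sub_le_self _
      (mul_nonneg (mul_nonneg hP.c_sub_pos.le (hrun.T_pos hP k ω).le) hdescent))
  · rw [(hrun.update_failure k ω hs).1]

lemma IsRun.gap_le_norm_G_sq (hrun : A.IsRun f P x0) (hP : P.Valid)
    (hf : SmoothStronglyConvex lam1 lamn f) (hlam1 : 0 < lam1) (htrue : ω ∈ A.trueEvent f k)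
    (y : E n) : 2 * lam1 * (f (A.X k ω) - f y) ≤ (1 + P.tmax) ^ 2 * ‖A.G k ω‖ ^ 2 := by
  rw [← mul_pow]
  exact (hf.polyak_lojasiewicz hlam1 (A.X k ω) y).trans
    (pow_le_pow_left₀ (norm_nonneg _) (hrun.norm_gradient_le hP htrue) 2)

lemma StepConstants.le_neg_inner (hc : A.StepConstants P lam1 lamn κ₁ κ₂ β) (k : ℕ) (ω : Ω) :
    β * κ₁ ^ 2 * ‖A.G k ω‖ ^ 2 ≤ -inner ℝ (A.G k ω) (A.S k ω) := by
  have hκ₁ := hc.κ₁_pos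
  have hβ := hc.β_pos
  calc β * κ₁ ^ 2 * ‖A.G k ω‖ ^ 2 = β * (κ₁ * ‖A.G k ω‖) ^ 2 := by ring
    _ ≤ β * ‖A.S k ω‖ ^ 2 := by gcongr; exact hc.lower k ω
    _ ≤ _ := hc.descent k ω

lemma StepConstants.M_pos (hc : A.StepConstants P lam1 lamn κ₁ κ₂ β) (hP : P.Valid)
    (hlam1 : 0 < lam1) (htbar : 0 < tbar) : 0 < P.M lam1 κ₁ β tbar := by
  have hcθ := hP.c_sub_pos
  have htmax := hP.tmax_pos
  have hκ₁ := hc.κ₁_pos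
  have hβ := hc.β_pos
  unfold Params.M
  positivity

lemma StepConstants.mul_le_one (hc : A.StepConstants P lam1 lamn κ₁ κ₂ β)
    (hrun : A.IsRun f P x0) (hP : P.Valid) (hf : SmoothStronglyConvex lam1 lamn f)
    (hlam1 : 0 < lam1) (htrue : ω ∈ A.trueEvent f k) {y : E n} (hy : f y < f (A.X k ω)) :
    β * κ₁ ≤ 1 := by
  have hG : 0 < ‖A.G k ω‖ := by
    refine (norm_nonneg _).lt_of_ne fun h0 => ?_
    have hgap := hrun.gap_le_norm_G_sq hP hf hlam1 htrue y
    rw [← h0, zero_pow two_ne_zero, mul_zero] at hgap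
    exact hgap.not_gt (mul_pos (mul_pos two_pos hlam1) (sub_pos.2 hy))
  refine le_of_mul_le_mul_right ?_ hG
  calc β * κ₁ * ‖A.G k ω‖ = β * (κ₁ * ‖A.G k ω‖) := mul_assoc _ _ _
    _ ≤ β * ‖A.S k ω‖ := mul_le_mul_of_nonneg_left (hc.lower k ω) hc.β_pos.le
    _ ≤ 1 * ‖A.G k ω‖ := by rw [one_mul]; exact mul_norm_le_of_descent (hc.descent k ω)

lemma StepConstants.M_lt_one (hc : A.StepConstants P lam1 lamn κ₁ κ₂ β) (hP : P.Valid)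
    (hlam1 : 0 < lam1) (htmax : tbar ≤ P.tmax) (hβκ₁ : β * κ₁ ≤ 1) : P.M lam1 κ₁ β tbar < 1 := by
  have htmax0 := hP.tmax_pos
  have hκ₁ := hc.κ₁_pos
  have hβ := hc.β_pos
  have hcθ := hP.c_sub_pos
  have hcθ1 : P.c - 2 * P.θ ≤ 1 := by linarith [hP.c_lt_one, hP.θ_pos]
  have hκ₁lam1 : κ₁ * lam1 ≤ 1 := (le_div_iff₀ hlam1).1 (hc.κ₁_le_κ₂.trans hc.κ₂_le)
  unfold Params.M
  rw [div_lt_one (by positivity)]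
  calc 2 * (P.c - 2 * P.θ) * β * κ₁ ^ 2 * lam1 * tbar
      = 2 * ((P.c - 2 * P.θ) * ((β * κ₁) * (κ₁ * lam1))) * tbar := by ring
    _ ≤ 2 * ((P.c - 2 * P.θ) * ((β * κ₁) * (κ₁ * lam1))) * P.tmax := by gcongr
    _ ≤ 2 * (1 * (1 * 1)) * P.tmax := by gcongr
    _ < (1 + P.tmax) ^ 2 := by nlinarith

lemma IsRun.gap_succ_le (hrun : A.IsRun f P x0) (hP : P.Valid)
    (hf : SmoothStronglyConvex lam1 lamn f) (hlam1 : 0 < lam1)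
    (hc : A.StepConstants P lam1 lamn κ₁ κ₂ β) (htrue : ω ∈ A.trueEvent f k)
    (hs : A.Successful P k ω) (htbar : 0 ≤ tbar) (hT : tbar ≤ A.T k ω) (y : E n) :
    f (A.X (k + 1) ω) - f y ≤ (1 - P.M lam1 κ₁ β tbar) * (f (A.X k ω) - f y) := by
  have hβ := hc.β_pos
  have hcθ := hP.c_sub_pos
  have htmax : 0 < 1 + P.tmax := add_pos one_pos hP.tmax_pos
  have hdecrease : P.M lam1 κ₁ β tbar * (f (A.X k ω) - f y) ≤
      (P.c - 2 * P.θ) * A.T k ω * -inner ℝ (A.G k ω) (A.S k ω) :=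
    calc P.M lam1 κ₁ β tbar * (f (A.X k ω) - f y)
        = (P.c - 2 * P.θ) * tbar * (β * κ₁ ^ 2) / (1 + P.tmax) ^ 2 *
            (2 * lam1 * (f (A.X k ω) - f y)) := by unfold Params.M; ring
      _ ≤ (P.c - 2 * P.θ) * tbar * (β * κ₁ ^ 2) / (1 + P.tmax) ^ 2 *
            ((1 + P.tmax) ^ 2 * ‖A.G k ω‖ ^ 2) :=
          mul_le_mul_of_nonneg_left (hrun.gap_le_norm_G_sq hP hf hlam1 htrue y) (by positivity)
      _ = (P.c - 2 * P.θ) * tbar * (β * κ₁ ^ 2 * ‖A.G k ω‖ ^ 2) := by field_simp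
      _ ≤ (P.c - 2 * P.θ) * A.T k ω * -inner ℝ (A.G k ω) (A.S k ω) :=
          mul_le_mul (mul_le_mul_of_nonneg_left hT hcθ.le) (hc.le_neg_inner k ω) (by positivity)
            (mul_nonneg hcθ.le (htbar.trans hT))
  linarith [hrun.decrease hs]

end RandomRun

/-! ### The level of the step length -/

section StepLevel

/-- The number of reductions by `τ` that take the step length `t` to `tbar`, rounded down;
it is negative for `t < tbar`. -/
noncomputable def stepLevel (τ tbar t : ℝ) : ℤ := ⌊Real.logb τ⁻¹ (t / tbar)⌋

variable {τ tbar t : ℝ}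

lemma stepLevel_mono (hτ0 : 0 < τ) (hτ1 : τ < 1) (htbar : 0 < tbar) (ht : 0 < t) {u : ℝ}
    (htu : t ≤ u) : stepLevel τ tbar t ≤ stepLevel τ tbar u :=
  Int.floor_mono (Real.logb_le_logb_of_le (one_lt_inv_iff₀.2 ⟨hτ0, hτ1⟩) (div_pos ht htbar)
    (div_le_div_of_nonneg_right htu htbar.le))

lemma stepLevel_inv_mul (hτ0 : 0 < τ) (hτ1 : τ < 1) (htbar : 0 < tbar) (ht : 0 < t) :
    stepLevel τ tbar (τ⁻¹ * t) = stepLevel τ tbar t + 1 := by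
  rw [stepLevel, stepLevel, ← Int.floor_add_one, mul_div_assoc,
    Real.logb_mul (inv_ne_zero hτ0.ne') (div_pos ht htbar).ne',
    Real.logb_self_eq_one (one_lt_inv_iff₀.2 ⟨hτ0, hτ1⟩), add_comm]

lemma stepLevel_mul (hτ0 : 0 < τ) (hτ1 : τ < 1) (htbar : 0 < tbar) (ht : 0 < t) :
    stepLevel τ tbar (τ * t) = stepLevel τ tbar t - 1 := by
  rw [eq_sub_iff_add_eq, ← stepLevel_inv_mul hτ0 hτ1 htbar (mul_pos hτ0 ht),
    inv_mul_cancel_left₀ hτ0.ne']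

lemma stepLevel_nonneg_iff (hτ0 : 0 < τ) (hτ1 : τ < 1) (htbar : 0 < tbar) (ht : 0 < t) :
    0 ≤ stepLevel τ tbar t ↔ tbar ≤ t := by
  rw [stepLevel, Int.floor_nonneg, Real.logb_nonneg_iff (one_lt_inv_iff₀.2 ⟨hτ0, hτ1⟩)
    (div_pos ht htbar), one_le_div htbar]

lemma stepLevel_nonpos_iff (hτ0 : 0 < τ) (hτ1 : τ < 1) (htbar : 0 < tbar) (ht : 0 < t) :
    stepLevel τ tbar t ≤ 0 ↔ τ * t < tbar := by
  rw [← not_le, ← stepLevel_nonneg_iff hτ0 hτ1 htbar (mul_pos hτ0 ht),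
    stepLevel_mul hτ0 hτ1 htbar ht]
  lia

lemma stepLevel_le_logb : (stepLevel τ tbar t : ℝ) ≤ Real.logb τ (tbar / t) :=
  (Int.floor_le _).trans_eq (by rw [Real.logb_inv_base, ← Real.logb_inv, inv_div])

end StepLevel

namespace RandomRun

variable {n : ℕ} {Ω : Type*} {f : E n → ℝ} {x0 : E n} {P : Params} {A : RandomRun n Ω}
  {lam1 lamn κ₁ κ₂ β tbar : ℝ} {k : ℕ} {ω : Ω}

lemma IsRun.stepLevel_failure (hrun : A.IsRun f P x0) (hP : P.Valid) (htbar : 0 < tbar)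
    (hs : ¬ A.Successful P k ω) :
    stepLevel P.τ tbar (A.T (k + 1) ω) = stepLevel P.τ tbar (A.T k ω) - 1 := by
  rw [(hrun.update_failure k ω hs).2,
    stepLevel_mul hP.τ_pos hP.τ_lt_one htbar (hrun.T_pos hP k ω)]

lemma IsRun.le_stepLevel_success (hrun : A.IsRun f P x0) (hP : P.Valid) (htbar : 0 < tbar)
    (hs : A.Successful P k ω) :
    stepLevel P.τ tbar (A.T k ω) ≤ stepLevel P.τ tbar (A.T (k + 1) ω) := by
  have hT := hrun.T_pos hP k ω
  rw [(hrun.update_success k ω hs).2]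
  exact stepLevel_mono hP.τ_pos hP.τ_lt_one htbar hT
    (le_min (hrun.T_le_tmax hP k ω) (le_mul_of_one_le_left hT.le hP.one_lt_inv_τ.le))

lemma IsRun.stepLevel_success_le (hrun : A.IsRun f P x0) (hP : P.Valid) (htbar : 0 < tbar)
    (hs : A.Successful P k ω) :
    stepLevel P.τ tbar (A.T (k + 1) ω) ≤ stepLevel P.τ tbar (A.T k ω) + 1 := by
  rw [← stepLevel_inv_mul hP.τ_pos hP.τ_lt_one htbar (hrun.T_pos hP k ω)]
  refine stepLevel_mono hP.τ_pos hP.τ_lt_one htbar (hrun.T_pos hP (k + 1) ω) ?_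
  rw [(hrun.update_success k ω hs).2]
  exact min_le_right _ _

lemma IsRun.stepLevel_success_of_lt (hrun : A.IsRun f P x0) (hP : P.Valid) (htbar : 0 < tbar)
    (ht0 : tbar ≤ P.τ * P.t0) (hs : A.Successful P k ω) (hT : A.T k ω < tbar) :
    stepLevel P.τ tbar (A.T (k + 1) ω) = stepLevel P.τ tbar (A.T k ω) + 1 := by
  have hcap : P.τ⁻¹ * A.T k ω ≤ P.tmax := by
    rw [inv_mul_le_iff₀ hP.τ_pos]
    exact hT.le.trans (ht0.trans (mul_le_mul_of_nonneg_left hP.t0_le_tmax hP.τ_pos.le))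
  rw [(hrun.update_success k ω hs).2, min_eq_right hcap,
    stepLevel_inv_mul hP.τ_pos hP.τ_lt_one htbar (hrun.T_pos hP k ω)]

lemma IsRun.abs_stepLevel_succ_le (hrun : A.IsRun f P x0) (hP : P.Valid) (htbar : 0 < tbar)
    (k : ℕ) (ω : Ω) :
    |stepLevel P.τ tbar (A.T (k + 1) ω)| ≤ |stepLevel P.τ tbar (A.T k ω)| + 1 := by
  refine sub_le_iff_le_add'.1 ((abs_sub_abs_le_abs_sub _ _).trans (abs_sub_le_iff.2 ?_))
  by_cases hs : A.Successful P k ω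
  · have hle := hrun.le_stepLevel_success hP htbar hs
    have hge := hrun.stepLevel_success_le hP htbar hs
    lia
  · have hfail := hrun.stepLevel_failure hP htbar hs
    lia

lemma IsRun.exists_T_eq (hrun : A.IsRun f P x0) (hP : P.Valid) {i : ℕ}
    (hi : P.t0 = P.τ ^ i * P.tmax) (k : ℕ) (ω : Ω) : ∃ m : ℕ, A.T k ω = P.τ ^ m * P.tmax := by
  induction k with
  | zero => exact ⟨i, by rw [hrun.T_zero, hi]⟩
  | succ k ih =>
    obtain ⟨m, hm⟩ := ih
    by_cases hs : A.Successful P k ω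
    · rw [(hrun.update_success k ω hs).2, hm]
      cases m with
      | zero =>
        rw [pow_zero, one_mul,
          min_eq_left (le_mul_of_one_le_left hP.tmax_pos.le hP.one_lt_inv_τ.le)]
        exact ⟨0, by rw [pow_zero, one_mul]⟩
      | succ m =>
        rw [pow_succ', mul_assoc, inv_mul_cancel_left₀ hP.τ_pos.ne', min_eq_right
          (mul_le_of_le_one_left hP.tmax_pos.le (pow_le_one₀ hP.τ_pos.le hP.τ_lt_one.le))]
        exact ⟨m, rfl⟩
    · rw [(hrun.update_failure k ω hs).2, hm]
      exact ⟨m + 1, by rw [pow_succ', mul_assoc]⟩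

lemma IsRun.T_le_of_grid (hrun : A.IsRun f P x0) (hP : P.Valid) {i j : ℕ}
    (hi : P.t0 = P.τ ^ i * P.tmax) (hj : tbar = P.τ ^ j * P.t0) (hT : P.τ * A.T k ω < tbar) :
    A.T k ω ≤ tbar := by
  obtain ⟨m, hm⟩ := hrun.exists_T_eq hP hi k ω
  rw [hi, ← mul_assoc, ← pow_add] at hj
  rw [hm, hj, ← mul_assoc, ← pow_succ', mul_lt_mul_iff_left₀ hP.tmax_pos,
    pow_lt_pow_iff_right_of_lt_one₀ hP.τ_pos hP.τ_lt_one] at hT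
  rw [hm, hj]
  exact mul_le_mul_of_nonneg_right
    (pow_le_pow_of_le_one hP.τ_pos.le hP.τ_lt_one.le (Nat.le_of_lt_succ hT)) hP.tmax_pos.le

lemma IsRun.T_le_of_stepLevel_nonpos (hrun : A.IsRun f P x0) (hP : P.Valid) {that : ℝ}
    (htbar : 0 < tbar) (hle : tbar ≤ that)
    (hgrid : (∃ i j : ℕ, P.t0 = P.τ ^ i * P.tmax ∧ tbar = P.τ ^ j * P.t0) ∨ tbar ≤ P.τ * that)
    (hlevel : stepLevel P.τ tbar (A.T k ω) ≤ 0) : A.T k ω ≤ that := by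
  rw [stepLevel_nonpos_iff hP.τ_pos hP.τ_lt_one htbar (hrun.T_pos hP k ω)] at hlevel
  rcases hgrid with ⟨i, j, hi, hj⟩ | hsmall
  · exact (hrun.T_le_of_grid hP hi hj hlevel).trans hle
  · exact le_of_mul_le_mul_left (hlevel.le.trans hsmall) hP.τ_pos

/-- An iteration is productive if it is true and successful with a step length of at least `tbar`:
these are the iterations in which the optimality gap is known to contract. -/
def Productive (A : RandomRun n Ω) (f : E n → ℝ) (P : Params) (tbar : ℝ) (k : ℕ) (ω : Ω) : Prop :=
  ω ∈ A.trueEvent f k ∧ A.Successful P k ω ∧ tbar ≤ A.T k ω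

lemma IsRun.abs_stepLevel_succ_le_sub_one (hrun : A.IsRun f P x0) (hP : P.Valid)
    (hf : SmoothStronglyConvex lam1 lamn f) (hlamn : 0 ≤ lamn)
    (hc : A.StepConstants P lam1 lamn κ₁ κ₂ β) (htbar : 0 < tbar)
    (hle : tbar ≤ P.threshold lamn κ₁ β) (ht0 : tbar ≤ P.τ * P.t0)
    (hgrid : (∃ i j : ℕ, P.t0 = P.τ ^ i * P.tmax ∧ tbar = P.τ ^ j * P.t0) ∨
      tbar ≤ P.τ * P.threshold lamn κ₁ β)
    (htrue : ω ∈ A.trueEvent f k) (hnot : ¬ A.Productive f P tbar k ω) :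
    |stepLevel P.τ tbar (A.T (k + 1) ω)| ≤ |stepLevel P.τ tbar (A.T k ω)| - 1 := by
  by_cases hs : A.Successful P k ω
  · have hlt : A.T k ω < tbar := not_le.1 fun hT => hnot ⟨htrue, hs, hT⟩
    have hneg : ¬ 0 ≤ stepLevel P.τ tbar (A.T k ω) := by
      rwa [stepLevel_nonneg_iff hP.τ_pos hP.τ_lt_one htbar (hrun.T_pos hP k ω), not_le]
    rw [hrun.stepLevel_success_of_lt hP htbar ht0 hs hlt, abs_of_nonpos (by lia),
      abs_of_neg (not_le.1 hneg)]
    lia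
  · have hpos : ¬ stepLevel P.τ tbar (A.T k ω) ≤ 0 := fun hlevel => hs <|
      hrun.successful_of_le_threshold hP hf hlamn hc htrue
        (hrun.T_le_of_stepLevel_nonpos hP htbar hle hgrid hlevel)
    rw [hrun.stepLevel_failure hP htbar hs, abs_of_nonneg (by lia), abs_of_pos (not_le.1 hpos)]

end RandomRun

/-! ### The pathwise iteration bound -/

section Pathwise

variable {p q : ℕ → Prop} [DecidablePred p] [DecidablePred q]

lemma natCast_add_le_of_potential {V : ℕ → ℤ} (hstep : ∀ k, V (k + 1) ≤ V k + 1)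
    (hdrop : ∀ k, ¬ p k → ¬ q k → V (k + 1) ≤ V k - 1) (K : ℕ) :
    K + V K ≤ V 0 + 2 * Nat.count p K + 2 * Nat.count q K := by
  induction K with
  | zero => simp
  | succ K ih =>
    have hVstep := hstep K
    have hVdrop := hdrop K
    rw [Nat.count_succ, Nat.count_succ]
    grind

lemma le_pow_count_mul {u : ℕ → ℝ} {r : ℝ} (hr : 0 ≤ r) (hu : ∀ k, u (k + 1) ≤ u k)
    (hcontract : ∀ k, p k → u (k + 1) ≤ r * u k) (K : ℕ) : u K ≤ r ^ Nat.count p K * u 0 := by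
  induction K with
  | zero => simp
  | succ K ih =>
    rw [Nat.count_succ]
    split_ifs with hp
    · calc u (K + 1) ≤ r * u K := hcontract K hp
        _ ≤ r * (r ^ Nat.count p K * u 0) := mul_le_mul_of_nonneg_left ih hr
        _ = r ^ (Nat.count p K + 1) * u 0 := by ring
    · exact (hu K).trans ih

lemma natCast_le_logb {M Δ ε : ℝ} (hM0 : 0 < M) (hM1 : M < 1) (hΔ : 0 < Δ) (hε : 0 < ε) {J : ℕ}
    (h : ε ≤ (1 - M) ^ J * Δ) : (J : ℝ) ≤ Real.logb (1 / (1 - M)) (Δ / ε) := by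
  have hpos : 0 < 1 - M := sub_pos.2 hM1
  rw [Real.le_logb_iff_rpow_le ((one_lt_div hpos).2 (sub_lt_self 1 hM0)) (div_pos hΔ hε),
    Real.rpow_natCast, one_div, inv_pow, le_div_iff₀ hε, inv_mul_le_iff₀ (pow_pos hpos J)]
  exact h

end Pathwise

lemma RandomRun.IsRun.natCast_le_of_lt_gap {n : ℕ} {Ω : Type*} {f : E n → ℝ} {x0 : E n} {P : Params}
    {A : RandomRun n Ω} {lam1 lamn κ₁ κ₂ β tbar ε : ℝ} {ω : Ω}
    [DecidablePred fun k => ω ∈ (A.trueEvent f k)ᶜ]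
    (hrun : A.IsRun f P x0) (hP : P.Valid)
    (hf : SmoothStronglyConvex lam1 lamn f) (hlam1 : 0 < lam1) (hlamn : lam1 ≤ lamn)
    (hc : A.StepConstants P lam1 lamn κ₁ κ₂ β) (htbar : 0 < tbar)
    (hle : tbar ≤ P.threshold lamn κ₁ β) (ht0 : tbar ≤ P.τ * P.t0)
    (hgrid : (∃ i j : ℕ, P.t0 = P.τ ^ i * P.tmax ∧ tbar = P.τ ^ j * P.t0) ∨
      tbar ≤ P.τ * P.threshold lamn κ₁ β)
    (hM1 : P.M lam1 κ₁ β tbar < 1) (hε : 0 < ε) (y : E n) {K : ℕ}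
    (hgap : ε < f (A.X K ω) - f y) :
    (K : ℝ) ≤ 2 * Real.logb (1 / (1 - P.M lam1 κ₁ β tbar)) ((f x0 - f y) / ε) +
      Real.logb P.τ (tbar / P.t0) + 2 * Nat.count (fun k => ω ∈ (A.trueEvent f k)ᶜ) K := by
  classical
  have hf_succ (k : ℕ) := hrun.f_succ_le hP hc k ω
  have hgap0 : 0 < f x0 - f y := by
    have hanti : f (A.X K ω) ≤ f (A.X 0 ω) :=
      antitone_nat_of_succ_le (f := fun k => f (A.X k ω)) hf_succ K.zero_le
    rw [hrun.X_zero] at hanti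
    linarith
  have hcontract := le_pow_count_mul (p := fun k => A.Productive f P tbar k ω)
    (u := fun k => f (A.X k ω) - f y) (sub_nonneg.2 hM1.le)
    (fun k => sub_le_sub_right (hf_succ k) _)
    (fun k hk => hrun.gap_succ_le hP hf hlam1 hc hk.1 hk.2.1 htbar.le hk.2.2 y) K
  have hproductive : (Nat.count (fun k => A.Productive f P tbar k ω) K : ℝ) ≤
      Real.logb (1 / (1 - P.M lam1 κ₁ β tbar)) ((f x0 - f y) / ε) :=
    natCast_le_logb (hc.M_pos hP hlam1 htbar) hM1 hgap0 hε
      (by simpa only [hrun.X_zero] using hgap.le.trans hcontract)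
  have hlevel0 : |stepLevel P.τ tbar (A.T 0 ω)| ≤ Real.logb P.τ (tbar / P.t0) := by
    have hnonneg : 0 ≤ stepLevel P.τ tbar P.t0 :=
      (stepLevel_nonneg_iff hP.τ_pos hP.τ_lt_one htbar hP.t0_pos).2
        (ht0.trans (mul_le_of_le_one_left hP.t0_pos.le hP.τ_lt_one.le))
    rw [hrun.T_zero, abs_of_nonneg hnonneg]
    exact stepLevel_le_logb
  have hpotential := natCast_add_le_of_potential (p := fun k => A.Productive f P tbar k ω)
    (q := fun k => ω ∈ (A.trueEvent f k)ᶜ) (hrun.abs_stepLevel_succ_le hP htbar · ω)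
    (fun k hnot htrue => hrun.abs_stepLevel_succ_le_sub_one hP hf (hlam1.le.trans hlamn) hc htbar
      hle ht0 hgrid (not_not.1 htrue) hnot) K
  have hcount : (K : ℤ) ≤ |stepLevel P.τ tbar (A.T 0 ω)| +
      2 * Nat.count (fun k => A.Productive f P tbar k ω) K +
      2 * Nat.count (fun k => ω ∈ (A.trueEvent f k)ᶜ) K :=
    (le_add_of_nonneg_right (abs_nonneg _)).trans hpotential
  have hcount' : (K : ℝ) ≤ (|stepLevel P.τ tbar (A.T 0 ω)| : ℤ) +
      2 * Nat.count (fun k => A.Productive f P tbar k ω) K +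
      2 * Nat.count (fun k => ω ∈ (A.trueEvent f k)ᶜ) K := by exact_mod_cast hcount
  linarith

/-! ### Measurability -/

namespace RandomRun

variable {n : ℕ} {Ω : Type*} {f : E n → ℝ} {x0 : E n} {P : Params} {A : RandomRun n Ω} {k : ℕ}

open Classical in
lemma IsRun.X_succ (hrun : A.IsRun f P x0) : A.X (k + 1) =
    fun ω => if A.Successful P k ω then A.X k ω + A.T k ω • A.S k ω else A.X k ω := by
  funext ω
  split_ifs with hs
  · exact (hrun.update_success k ω hs).1
  · exact (hrun.update_failure k ω hs).1

open Classical in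
lemma IsRun.T_succ (hrun : A.IsRun f P x0) : A.T (k + 1) =
    fun ω => if A.Successful P k ω then min P.tmax (P.τ⁻¹ * A.T k ω) else P.τ * A.T k ω := by
  funext ω
  split_ifs with hs
  · exact (hrun.update_success k ω hs).2
  · exact (hrun.update_failure k ω hs).2

variable {mΩ : MeasurableSpace Ω} {ℱ : Filtration ℕ mΩ}

lemma IsRun.measurable_X_T (hrun : A.IsRun f P x0) (hA : A.Adapted ℱ) (k : ℕ) :
    Measurable[ℱ k] (A.X k) ∧ Measurable[ℱ k] (A.T k) := by
  induction k with
  | zero =>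
    rw [funext hrun.X_zero, funext hrun.T_zero]
    exact ⟨@measurable_const _ _ _ (ℱ 0) _, @measurable_const _ _ _ (ℱ 0) _⟩
  | succ k ih =>
    have hX := ih.1.mono (ℱ.mono k.le_succ) le_rfl
    have hT := ih.2.mono (ℱ.mono k.le_succ) le_rfl
    have hS := hA.S_meas k
    have hs : MeasurableSet[ℱ (k + 1)] {ω | A.Successful P k ω} :=
      measurableSet_le (hA.ftrial_meas k)
        ((hA.fcur_meas k).add ((hT.const_mul P.c).mul (hS.inner (hA.G_meas k))))
    rw [hrun.X_succ, hrun.T_succ]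
    exact ⟨Measurable.ite hs (hX.add (hT.smul hS)) hX,
      Measurable.ite hs (measurable_const.min (hT.const_mul _)) (hT.const_mul _)⟩

lemma IsRun.measurableSet_trueEvent (hrun : A.IsRun f P x0) (hA : A.Adapted ℱ)
    (hf : Continuous (gradient f)) (k : ℕ) : MeasurableSet[ℱ (k + 1)] (A.trueEvent f k) := by
  have hX := (hrun.measurable_X_T hA k).1.mono (ℱ.mono k.le_succ) le_rfl
  have hT := (hrun.measurable_X_T hA k).2.mono (ℱ.mono k.le_succ) le_rfl
  exact measurableSet_le
    (measurable_norm.comp ((hA.G_meas k).sub (hf.measurable.comp hX)))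
    ((hT.mul (hA.η_meas k)).mul (measurable_norm.comp (hA.G_meas k)))

lemma IsRun.measurableSet_lt_gap (hrun : A.IsRun f P x0) (hA : A.Adapted ℱ)
    (hf : Continuous f) (fstar ε : ℝ) (k : ℕ) :
    MeasurableSet[ℱ k] {ω | ε < f (A.X k ω) - fstar} :=
  measurableSet_lt measurable_const
    ((hf.measurable.comp (hrun.measurable_X_T hA k).1).sub_const fstar)

end RandomRun

/-! ### Expected duration of a decreasing sequence of events -/

section Duration

variable {Ω : Type*} {mΩ : MeasurableSpace Ω} {μ : Measure Ω}

lemma measureReal_inter_compl_le [IsFiniteMeasure μ] {m : MeasurableSpace Ω} (hm : m ≤ mΩ)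
    {s B : Set Ω} {δ : ℝ} (hs : MeasurableSet[mΩ] s) (hB : MeasurableSet[m] B)
    (h : ∀ᵐ ω ∂μ, 1 - δ ≤ (μ⟦s | m⟧) ω) : μ.real (B ∩ sᶜ) ≤ δ * μ.real B := by
  have hcond : ∫ ω in B, (μ⟦s | m⟧) ω ∂μ = μ.real (B ∩ s) := by
    rw [setIntegral_condExp hm ((integrable_const (1 : ℝ)).indicator hs) hB,
      setIntegral_indicator hs, setIntegral_const, smul_eq_mul, mul_one]
  have hlower : μ.real B * (1 - δ) ≤ μ.real (B ∩ s) := by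
    rw [← hcond, ← smul_eq_mul, ← setIntegral_const]
    exact setIntegral_mono_ae (integrable_const _).integrableOn integrable_condExp.integrableOn h
  have hsplit : μ.real (B ∩ s) + μ.real (B \ s) = μ.real B := measureReal_inter_add_sdiff hs
  rw [← Set.sdiff_eq]
  linarith

lemma natCast_le_tsum_indicator {B : ℕ → Set Ω} {ω : Ω} {m : ℕ} (h : ∀ k < m, ω ∈ B k) :
    (m : ℝ≥0∞) ≤ ∑' k, (B k).indicator 1 ω :=
  calc (m : ℝ≥0∞) = ∑ k ∈ Finset.range m, (B k).indicator 1 ω := by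
        rw [Finset.sum_congr rfl fun k hk =>
          Set.indicator_of_mem (h k (Finset.mem_range.1 hk)) _]
        simp
    _ ≤ _ := ENNReal.sum_le_tsum _

lemma iInf_notMem_le_tsum_indicator (B : ℕ → Set Ω) (ω : Ω) :
    ((⨅ (k : ℕ) (_ : ω ∉ B k), (k : ℕ∞) : ℕ∞) : ℝ≥0∞) ≤ ∑' k, (B k).indicator 1 ω := by
  have hle (m : ℕ) (hm : (m : ℕ∞) ≤ ⨅ (k : ℕ) (_ : ω ∉ B k), (k : ℕ∞)) :
      (m : ℝ≥0∞) ≤ ∑' k, (B k).indicator 1 ω :=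
    natCast_le_tsum_indicator fun k hk => by
      by_contra hkB
      exact hk.not_ge (Nat.cast_le.1 (hm.trans (iInf₂_le k hkB)))
  generalize (⨅ (k : ℕ) (_ : ω ∉ B k), (k : ℕ∞) : ℕ∞) = N at hle
  cases N with
  | top =>
    rw [ENat.toENNReal_top, ← ENNReal.iSup_natCast]
    exact iSup_le fun m => hle m le_top
  | coe m => exact hle m le_rfl

lemma lintegral_iInf_notMem_le_tsum {B : ℕ → Set Ω} (hB : ∀ k, MeasurableSet (B k)) :
    ∫⁻ ω, ((⨅ (k : ℕ) (_ : ω ∉ B k), (k : ℕ∞) : ℕ∞) : ℝ≥0∞) ∂μ ≤ ∑' k, μ (B k) :=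
  calc _ ≤ ∫⁻ ω, ∑' k, (B k).indicator 1 ω ∂μ := lintegral_mono (iInf_notMem_le_tsum_indicator B)
    _ = ∑' k, μ (B k) := by
      rw [lintegral_tsum fun k => (measurable_one.indicator (hB k)).aemeasurable]
      exact tsum_congr fun k => lintegral_indicator_one (hB k)

lemma count_le_of_natCast_le {p q : ℕ → Prop} [DecidablePred p] [DecidablePred q] {C : ℝ}
    (hC : 0 ≤ 1 + C) (hp : ∀ k, p (k + 1) → p k)
    (h : ∀ K : ℕ, p K → (K : ℝ) ≤ C + 2 * Nat.count q K) (K : ℕ) :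
    (Nat.count p K : ℝ) ≤ 1 + C + 2 * Nat.count (fun k => p k ∧ q k) K := by
  induction K with
  | zero => simpa using hC
  | succ K ih =>
    by_cases hK : p K
    · have hall : ∀ k ≤ K, p k := fun k hk => Nat.decreasingInduction (fun j _ => hp j) hK hk
      have hcount : Nat.count q K ≤ Nat.count (fun k => p k ∧ q k) (K + 1) :=
        (Nat.count_mono_left fun k hk hq => ⟨hall k hk.le, hq⟩).trans
          (Nat.count_monotone _ K.le_succ)
      have hcount' : (Nat.count q K : ℝ) ≤ Nat.count (fun k => p k ∧ q k) (K + 1) :=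
        Nat.cast_le.2 hcount
      rw [Nat.count_iff_forall.2 fun k hk => hall k (Nat.le_of_lt_succ hk), Nat.cast_succ]
      linarith [h K hK]
    · simpa [Nat.count_succ, hK] using ih

lemma natCast_count_eq_sum_indicator (B : ℕ → Set Ω) (ω : Ω) [DecidablePred (ω ∈ B ·)] (K : ℕ) :
    (Nat.count (ω ∈ B ·) K : ℝ) = ∑ k ∈ Finset.range K, (B k).indicator 1 ω := by
  classical
  simp [Nat.count_eq_card_filter_range, Set.indicator_apply]

lemma integrable_indicator_one [IsFiniteMeasure μ] {s : Set Ω} (hs : MeasurableSet s) :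
    Integrable (s.indicator (1 : Ω → ℝ)) μ :=
  (integrable_const (1 : ℝ)).indicator hs

lemma integral_sum_indicator_one [IsFiniteMeasure μ] {B : ℕ → Set Ω}
    (hB : ∀ k, MeasurableSet (B k)) (K : ℕ) :
    ∫ ω, ∑ k ∈ Finset.range K, (B k).indicator (1 : Ω → ℝ) ω ∂μ =
      ∑ k ∈ Finset.range K, μ.real (B k) := by
  rw [integral_finsetSum _ fun k _ => integrable_indicator_one (hB k)]
  exact Finset.sum_congr rfl fun k _ => integral_indicator_one (hB k)

variable [IsProbabilityMeasure μ] {B W : ℕ → Set Ω} [∀ ω, DecidablePred (ω ∈ W ·)] {C δ : ℝ}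

lemma sum_measureReal_le_add (hC : 0 ≤ 1 + C)
    (hB : ∀ k, MeasurableSet (B k)) (hW : ∀ k, MeasurableSet (W k)) (hanti : ∀ k, B (k + 1) ⊆ B k)
    (hpath : ∀ K : ℕ, ∀ ω ∈ B K, (K : ℝ) ≤ C + 2 * Nat.count (ω ∈ W ·) K) (K : ℕ) :
    ∑ k ∈ Finset.range K, μ.real (B k) ≤
      1 + C + 2 * ∑ k ∈ Finset.range K, μ.real (B k ∩ W k) := by
  classical
  have hBW (k : ℕ) : MeasurableSet (B k ∩ W k) := (hB k).inter (hW k)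
  have hint : Integrable
      (fun ω => 2 * ∑ k ∈ Finset.range K, (B k ∩ W k).indicator (1 : Ω → ℝ) ω) μ :=
    (integrable_finsetSum _ fun k _ => integrable_indicator_one (hBW k)).const_mul 2
  have hpoint (ω : Ω) : ∑ k ∈ Finset.range K, (B k).indicator (1 : Ω → ℝ) ω ≤
      1 + C + 2 * ∑ k ∈ Finset.range K, (B k ∩ W k).indicator (1 : Ω → ℝ) ω := by
    rw [← natCast_count_eq_sum_indicator B, ← natCast_count_eq_sum_indicator fun k => B k ∩ W k]
    exact count_le_of_natCast_le hC (fun k hk => hanti k hk) (hpath · ω) K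
  calc ∑ k ∈ Finset.range K, μ.real (B k)
      = ∫ ω, ∑ k ∈ Finset.range K, (B k).indicator (1 : Ω → ℝ) ω ∂μ :=
        (integral_sum_indicator_one hB K).symm
    _ ≤ ∫ ω, (1 + C + 2 * ∑ k ∈ Finset.range K, (B k ∩ W k).indicator (1 : Ω → ℝ) ω) ∂μ :=
        integral_mono (integrable_finsetSum _ fun k _ => integrable_indicator_one (hB k))
          ((integrable_const _).add hint) hpoint
    _ = 1 + C + 2 * ∑ k ∈ Finset.range K, μ.real (B k ∩ W k) := by
        rw [integral_add (integrable_const _) hint, integral_const_mul,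
          integral_sum_indicator_one hBW, integral_const, probReal_univ, one_smul]

lemma lintegral_iInf_notMem_le (hC : 0 ≤ 1 + C) (hδ : δ < 1 / 2)
    (hB : ∀ k, MeasurableSet (B k)) (hW : ∀ k, MeasurableSet (W k)) (hanti : ∀ k, B (k + 1) ⊆ B k)
    (hBW : ∀ k, μ.real (B k ∩ W k) ≤ δ * μ.real (B k))
    (hpath : ∀ K : ℕ, ∀ ω ∈ B K, (K : ℝ) ≤ C + 2 * Nat.count (ω ∈ W ·) K) :
    ∫⁻ ω, ((⨅ (k : ℕ) (_ : ω ∉ B k), (k : ℕ∞) : ℕ∞) : ℝ≥0∞) ∂μ ≤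
      ENNReal.ofReal ((1 + C) / (1 - 2 * δ)) := by
  refine (lintegral_iInf_notMem_le_tsum hB).trans (ENNReal.tsum_le_of_sum_range_le fun K => ?_)
  have hrare : ∑ k ∈ Finset.range K, μ.real (B k ∩ W k) ≤
      δ * ∑ k ∈ Finset.range K, μ.real (B k) := by
    rw [Finset.mul_sum]
    exact Finset.sum_le_sum fun k _ => hBW k
  have hsum := sum_measureReal_le_add (μ := μ) hC hB hW hanti hpath K
  rw [← Finset.sum_congr rfl fun k _ => ofReal_measureReal,
    ← ENNReal.ofReal_sum_of_nonneg fun k _ => measureReal_nonneg]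
  refine ENNReal.ofReal_le_ofReal ((le_div_iff₀ (by linarith)).2 ?_)
  linarith

end Duration

/-! ### The expected hitting time -/

lemma nonempty_of_le_condExp_indicator {Ω : Type*} {m mΩ : MeasurableSpace Ω} {μ : Measure Ω}
    [NeZero μ] {s : Set Ω} {δ : ℝ} (hδ : δ < 1) (h : ∀ᵐ ω ∂μ, 1 - δ ≤ (μ⟦s | m⟧) ω) :
    s.Nonempty := by
  by_contra! hs
  rw [hs, Set.indicator_empty, ← Pi.zero_def, condExp_zero] at h
  obtain ⟨_, hle⟩ := h.exists
  exact (sub_pos.2 hδ).not_ge hle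

lemma one_le_two_mul_logb_add_logb {τ t t0 M Δ ε : ℝ} (hτ0 : 0 < τ) (hτ1 : τ < 1) (ht : 0 < t)
    (ht0 : 0 < t0) (htt0 : t ≤ τ * t0) (hM0 : 0 < M) (hM1 : M < 1) (hε : 0 < ε) (hεΔ : ε ≤ Δ) :
    1 ≤ 2 * Real.logb (1 / (1 - M)) (Δ / ε) + Real.logb τ (t / t0) := by
  have hgap : 0 ≤ Real.logb (1 / (1 - M)) (Δ / ε) :=
    Real.logb_nonneg ((one_lt_div (sub_pos.2 hM1)).2 (sub_lt_self 1 hM0)) ((one_le_div hε).2 hεΔ)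
  have hstep : 1 ≤ Real.logb τ (t / t0) := by
    rwa [Real.le_logb_iff_rpow_le_of_base_lt_one hτ0 hτ1 (div_pos ht ht0), Real.rpow_one,
      div_le_iff₀ ht0]
  linarith

lemma one_add_div_le_mul {δ C : ℝ} (hδ0 : 0 ≤ δ) (hδ : δ < 1 / 2) (hC : 1 ≤ C) :
    (1 + C) / (1 - 2 * δ) ≤ 2 * (1 - δ) / (1 - 2 * δ) ^ 2 * C := by
  have hpos : 0 < 1 - 2 * δ := by linarith
  calc (1 + C) / (1 - 2 * δ) = (1 + C) * (1 - 2 * δ) / (1 - 2 * δ) ^ 2 := by field_simp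
    _ ≤ 2 * (1 - δ) * C / (1 - 2 * δ) ^ 2 :=
        div_le_div_of_nonneg_right (by linarith) (sq_nonneg _)
    _ = 2 * (1 - δ) / (1 - 2 * δ) ^ 2 * C := by ring

namespace RandomRun

variable {n : ℕ} {Ω : Type*} {f : E n → ℝ} {A : RandomRun n Ω}

lemma hittingTime_eq (fstar ε : ℝ) (ω : Ω) : A.hittingTime f fstar ε ω =
    ⨅ (k : ℕ) (_ : ω ∉ {ω | ε < f (A.X k ω) - fstar}), (k : ℕ∞) := by
  simp only [hittingTime, Set.mem_ofPred_eq, not_lt]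

lemma IsRun.lintegral_hittingTime_le {mΩ : MeasurableSpace Ω} {μ : Measure Ω}
    [IsProbabilityMeasure μ] {ℱ : Filtration ℕ mΩ} {x0 : E n} {P : Params}
    {lam1 lamn κ₁ κ₂ β tbar δ ε : ℝ}
    (hrun : A.IsRun f P x0) (hA : A.Adapted ℱ) (hP : P.Valid)
    (hf : SmoothStronglyConvex lam1 lamn f) (hlam1 : 0 < lam1) (hlamn : lam1 ≤ lamn)
    (hδ : δ < 1 / 2) (hacc : A.GradientAccurate μ ℱ f δ)
    (hc : A.StepConstants P lam1 lamn κ₁ κ₂ β) (htbar : 0 < tbar)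
    (hle : tbar ≤ P.threshold lamn κ₁ β) (ht0 : tbar ≤ P.τ * P.t0)
    (hgrid : (∃ i j : ℕ, P.t0 = P.τ ^ i * P.tmax ∧ tbar = P.τ ^ j * P.t0) ∨
      tbar ≤ P.τ * P.threshold lamn κ₁ β)
    (hM1 : P.M lam1 κ₁ β tbar < 1) (hε : 0 < ε) {y : E n} (hεy : ε ≤ f x0 - f y) :
    ∫⁻ ω, (A.hittingTime f (f y) ε ω : ℝ≥0∞) ∂μ ≤
      ENNReal.ofReal
        ((1 + (2 * Real.logb (1 / (1 - P.M lam1 κ₁ β tbar)) ((f x0 - f y) / ε) +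
          Real.logb P.τ (tbar / P.t0))) / (1 - 2 * δ)) := by
  classical
  have hbound := one_le_two_mul_logb_add_logb hP.τ_pos hP.τ_lt_one htbar hP.t0_pos ht0
    (hc.M_pos hP hlam1 htbar) hM1 hε hεy
  have hgap := hrun.measurableSet_lt_gap hA hf.1.continuous (f y) ε
  have htrue := hrun.measurableSet_trueEvent hA hf.continuous_gradient
  simp only [hittingTime_eq]
  exact lintegral_iInf_notMem_le (by linarith) hδ (fun k => ℱ.le k _ (hgap k))
    (fun k => (ℱ.le (k + 1) _ (htrue k)).compl)
    (fun k ω (hω : _ < _) => hω.trans_le (sub_le_sub_right (hrun.f_succ_le hP hc k ω) _))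
    (fun k => measureReal_inter_compl_le (ℱ.le k) (ℱ.le (k + 1) _ (htrue k)) (hgap k) (hacc k))
    fun K ω => hrun.natCast_le_of_lt_gap hP hf hlam1 hlamn hc htbar hle ht0 hgrid hM1 hε y

end RandomRun

end NewtonCG

theorem theorem4p4 {n : ℕ} {Ω : Type*} {mΩ : MeasurableSpace Ω}
    (μ : Measure Ω) [IsProbabilityMeasure μ] (ℱ : Filtration ℕ mΩ)
    (f : NewtonCG.E n → ℝ) (xstar x0 : NewtonCG.E n) (lam1 lamn δg ε : ℝ)
    (P : NewtonCG.Params) (A : NewtonCG.RandomRun n Ω)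
    (hP : P.Valid)
    (hlam1 : 0 < lam1) (hlamn : lam1 ≤ lamn)
    (hf : NewtonCG.SmoothStronglyConvex lam1 lamn f)
    (hxstar : ∀ x, f xstar ≤ f x)
    (hrun : A.IsRun f P x0) (hadapted : A.Adapted ℱ)
    (hH : ∀ k ω, NewtonCG.SpectralBounds lam1 lamn (A.H k ω))
    (hδ0 : 0 < δg) (hδ : δg < 1 / 2)
    (hacc : A.GradientAccurate μ ℱ f δg)
    (hε : 0 < ε) (hε0 : ε ≤ f x0 - f xstar) :
    A.StepConstants P lam1 lamn ((1 - P.ηbar) / lamn) (1 / lam1) lam1 ∧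
    ∀ κ₁ κ₂ β tbar : ℝ,
      A.StepConstants P lam1 lamn κ₁ κ₂ β →
      0 < tbar → tbar ≤ P.threshold lamn κ₁ β → tbar ≤ P.τ * P.t0 →
      ((∃ i j : ℕ, P.t0 = P.τ ^ i * P.tmax ∧ tbar = P.τ ^ j * P.t0) ∨
        tbar ≤ P.τ * P.threshold lamn κ₁ β) →
      0 < P.M lam1 κ₁ β tbar ∧ P.M lam1 κ₁ β tbar < 1 ∧
      ∫⁻ ω, (A.hittingTime f (f xstar) ε ω : ℝ≥0∞) ∂μ ≤
        ENNReal.ofReal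
          (2 * (1 - δg) / (1 - 2 * δg) ^ 2 *
            (2 * Real.logb (1 / (1 - P.M lam1 κ₁ β tbar)) ((f x0 - f xstar) / ε) +
              Real.logb P.τ (tbar / P.t0))) := by
  refine ⟨hrun.stepConstants hP hlam1 hlamn hH, fun κ₁ κ₂ β tbar hc htbar hle ht0 hgrid => ?_⟩
  obtain ⟨ω, htrue⟩ := NewtonCG.nonempty_of_le_condExp_indicator (by linarith) (hacc 0)
  have hgap : f xstar < f (A.X 0 ω) := by rw [hrun.X_zero]; linarith
  have htmax : tbar ≤ P.tmax :=
    ht0.trans ((mul_le_of_le_one_left hP.t0_pos.le hP.τ_lt_one.le).trans hP.t0_le_tmax)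
  have hM0 := hc.M_pos hP hlam1 htbar
  have hM1 := hc.M_lt_one hP hlam1 htmax (hc.mul_le_one hrun hP hf hlam1 htrue hgap)
  have hbound := NewtonCG.one_le_two_mul_logb_add_logb hP.τ_pos hP.τ_lt_one htbar hP.t0_pos ht0
    hM0 hM1 hε hε0
  exact ⟨hM0, hM1, (hrun.lintegral_hittingTime_le hadapted hP hf hlam1 hlamn hδ hacc hc htbar hle
    ht0 hgrid hM1 hε hε0).trans
    (ENNReal.ofReal_le_ofReal (NewtonCG.one_add_div_le_mul hδ0.le hδ hbound))⟩
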